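/- Let $V=\mathbb{C}^m$ and let $\mathrm{Sym}^dV\subseteq\bigotimes^dV$ be the space of symmetric tensors, identified with the homogeneous polynomials of degree $d$ in $m$ variables: the monomial $x_{i_1}\cdots x_{i_d}$ corresponds to $e_{i_1}\odot\cdots\odot e_{i_d}$, where $v_1\odot\cdots\odot v_d:=\frac1{d!}\sum_{\pi\in\mathfrak{S}_d}v_{\pi(1)}\otimes\cdots\otimes v_{\pi(d)}$. The Waring rank $\mathsf{WR}(p)$ is the least $r$ such that $p=\sum_{i=1}^r\ell_i^{\otimes d}$ for some $\ell_i\in V$. A noncommutative algebraic branching program (ncABP) is a finite layered directed graph (edges only lead from one layer to the next) with a source, a sink whose layer is $d$ layers after that of the source, and edges labelled by elements of $V$. It computes the tensor $\sum_P \ell_1(P)\otimes\cdots\otimes\ell_d(P)\in\bigotimes^dV$, where $P$ runs over the source-sink paths and $\ell_1(P),\dots,\ell_d(P)$ are the labels along $P$. Its width is the largest number of vertices in a layer, and $\mathsf{ncw}(p)$ is the least width of an ncABP computing $p$. The border Waring rank $\underline{\mathsf{WR}}(p)$ (resp. $\underline{\mathsf{ncw}}(p)$) is the least $r$ such that $p$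 lies in the closure, in $\bigotimes^dV$, of the set of tensors $q$ with $\mathsf{WR}(q)\le r$ (resp. $\mathsf{ncw}(q)\le r$). Define the subsets of $\mathrm{Sym}^dV$ $$W_{k,d}=\{\mathsf{WR}\le k\},\quad \overline{W_{k,d}}=\{\underline{\mathsf{WR}}\le k\},\quad B_{k,d}=\{\mathsf{ncw}\le k\},\quad \overline{B_{k,d}}=\{\underline{\mathsf{ncw}}\le k\}.$$ Then for all $m\ge 0$ and all $k,d\ge1$ $$W_{k,d}\subseteq\overline{W_{k,d}}\subseteq B_{k,d}=\overline{B_{k,d}},$$ and there are $m$ and $k,d\ge1$ for which both inclusions are strict: $W_{k,d}\subsetneq\overline{W_{k,d}}\subsetneq B_{k,d}$. Moreover, the following elements witness strictness. If $2\le k<d$ and $x\ne y$ are two of the variables, then $x^{d-1}y\in\overline{W_{k,d}}\setminus W_{k,d}$. For $V=\mathbb{C}^{2\times2}$, the $2\times2$ matrix multiplication polynomial $x_{11}^3+3x_{11}x_{12}x_{21}+3x_{12}x_{22}x_{21}+x_{22}^3$ lies in $B_{4,3}\setminus\overline{W_{4,3}}$. -/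

import Mathlib

open scoped BigOperators

noncomputable section

namespace WaringABP

/-- An order `d` tensor over `V = ℂ^ι`: a `d`-dimensional array of complex numbers.
Its topology is that of entrywise (coefficientwise) convergence. -/
abbrev Tensor (ι : Type) (d : ℕ) : Type := (Fin d → ι) → ℂ

/-- The elementary tensor `v₁ ⊗ ⋯ ⊗ v_d`. -/
def pureTensor {ι : Type} {d : ℕ} (v : Fin d → ι → ℂ) : Tensor ι d :=
  fun i => ∏ j, v j (i j)

/-- Symmetric tensors, i.e. the elements of `Sym^d V ⊆ ⊗^d V`. -/
def IsSymm {ι : Type} {d : ℕ} (T : Tensor ι d) : Prop :=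
  ∀ (σ : Equiv.Perm (Fin d)) (i : Fin d → ι), T (i ∘ σ) = T i

/-- The symmetric product `v₁ ⊙ ⋯ ⊙ v_d = (1/d!) ∑_π v_{π(1)} ⊗ ⋯ ⊗ v_{π(d)}`. On basis vectors it
is the symmetric tensor that corresponds to the monomial `x_{i₁} ⋯ x_{i_d}`. -/
def symProd {ι : Type} {d : ℕ} (v : Fin d → ι → ℂ) : Tensor ι d :=
  ((d.factorial : ℂ)⁻¹) • ∑ σ : Equiv.Perm (Fin d), pureTensor (fun j => v (σ j))

/-- The Waring rank: the least `r` such that `T` is a sum of `r` powers `ℓ^{⊗d}` of vectors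
(linear forms) `ℓ`; it is `⊤` if there is no such `r`. -/
def waringRank {ι : Type} {d : ℕ} (T : Tensor ι d) : ℕ∞ :=
  ⨅ (r : ℕ) (_ : ∃ l : Fin r → ι → ℂ, T = ∑ a, pureTensor (fun _ => l a)), (r : ℕ∞)

/-- The border Waring rank: the least `r` such that `T` lies in the closure of the set of tensors
of Waring rank at most `r`. -/
def borderWaringRank {ι : Type} {d : ℕ} (T : Tensor ι d) : ℕ∞ :=
  ⨅ (r : ℕ) (_ : T ∈ closure {S : Tensor ι d | waringRank S ≤ r}), (r : ℕ∞)

/-- A noncommutative algebraic branching program whose source-sink paths have length `d`: a finite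
layered directed graph, edges leading from a layer to the next one only, with a source and a
sink, and with edges labelled by elements of `V = ℂ^ι`.
(Values of `label` at non-adjacent pairs are never used.) -/
structure NcABP (ι : Type) (d : ℕ) where
  Vert : Type
  [fintypeVert : Fintype Vert]
  graph : Digraph Vert
  layer : Vert → ℕ
  layer_adj : ∀ u v, graph.Adj u v → layer v = layer u + 1
  source : Vert
  sink : Vert
  layer_sink : layer sink = layer source + d
  label : Vert → Vert → ι → ℂ

attribute [instance] NcABP.fintypeVert

/-- The sequence of vertices `P` is a directed path from the source to the sink. -/
def NcABP.IsPath {ι : Type} {d : ℕ} (A : NcABP ι d) (P : Fin (d + 1) → A.Vert) : Prop :=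
  P 0 = A.source ∧ P (Fin.last d) = A.sink ∧ ∀ j : Fin d, A.graph.Adj (P j.castSucc) (P j.succ)

open Classical in
/-- The tensor computed by `A`: the sum over all source-sink paths of the tensor product of the
edge labels along the path. -/
def NcABP.tensor {ι : Type} {d : ℕ} (A : NcABP ι d) : Tensor ι d :=
  ∑ P : Fin (d + 1) → A.Vert with A.IsPath P,
    pureTensor (fun j => A.label (P j.castSucc) (P j.succ))

/-- The width of `A`: the largest number of vertices in a layer. -/
def NcABP.width {ι : Type} {d : ℕ} (A : NcABP ι d) : ℕ :=
  Finset.univ.sup fun v : A.Vert => (Finset.univ.filter fun u => A.layer u = A.layer v).card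

/-- `ncw(T)`: the least width of an ncABP that computes `T`. -/
def ncw {ι : Type} {d : ℕ} (T : Tensor ι d) : ℕ∞ :=
  ⨅ (A : NcABP ι d) (_ : A.tensor = T), (A.width : ℕ∞)

/-- The border version of `ncw`; the approximating tensors need not be symmetric. -/
def borderNcw {ι : Type} {d : ℕ} (T : Tensor ι d) : ℕ∞ :=
  ⨅ (r : ℕ) (_ : T ∈ closure {S : Tensor ι d | ncw S ≤ r}), (r : ℕ∞)

/-- `W_{k,d}` -/
def W (ι : Type) (k d : ℕ) : Set (Tensor ι d) := {p | IsSymm p ∧ waringRank p ≤ k}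

/-- `\overline{W_{k,d}}` -/
def WBar (ι : Type) (k d : ℕ) : Set (Tensor ι d) := {p | IsSymm p ∧ borderWaringRank p ≤ k}

/-- `B_{k,d}` -/
def B (ι : Type) (k d : ℕ) : Set (Tensor ι d) := {p | IsSymm p ∧ ncw p ≤ k}

/-- `\overline{B_{k,d}}` -/
def BBar (ι : Type) (k d : ℕ) : Set (Tensor ι d) := {p | IsSymm p ∧ borderNcw p ≤ k}

/-- The standard basis vector `e_i`, identified with the variable `x_i`. -/
def e {ι : Type} [DecidableEq ι] (i : ι) : ι → ℂ := Pi.single i 1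

/-- The symmetric tensor of the monomial `x^{d-1} y` (for `d ≥ 1`). -/
def monomialTensor {ι : Type} [DecidableEq ι] (d : ℕ) (x y : ι) : Tensor ι d :=
  symProd fun j : Fin d => if (j : ℕ) = 0 then e y else e x

/-- The symmetric tensor of the `2 × 2` matrix multiplication polynomial
`tr X³ = x₁₁³ + 3 x₁₁ x₁₂ x₂₁ + 3 x₁₂ x₂₂ x₂₁ + x₂₂³` (rows and columns are numbered 0, 1). -/
def matMulTensor : Tensor (Fin 2 × Fin 2) 3 :=
  symProd ![e (0, 0), e (0, 0), e (0, 0)] + (3 : ℂ) • symProd ![e (0, 0), e (0, 1), e (1, 0)]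
    + (3 : ℂ) • symProd ![e (0, 1), e (1, 1), e (1, 0)] + symProd ![e (1, 1), e (1, 1), e (1, 1)]

end WaringABP

end

noncomputable section
namespace WaringABP

open scoped Topology

/-! ### Ranks as infima -/

/-! Everything is compared through flattenings. Cutting a program of width k after j steps writes
its tensor as a sum, over the at most k vertices of that layer, of (paths into v) ⊗ (paths out of
v), so every proper flattening has rank at most k. Conversely (Nisan), spanning families of column
spaces of dimension at most k serve as the layers of a program. So for k, d ≥ 1, `ncw` at most k is
equivalent to `FlatteningRankLE k`, a closed condition that also holds for sums of k powers. This
gives `B = BBar` and `WBar ⊆ B`.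

Strictness: x^{d-1}y is the limit of ((x+ty)^d − x^d)/(dt), but for fewer than d linear forms there
is an apolar form killing their d-th powers and not x^{d-1}y. Strassen's commutation relations
between slices hold for sums of |ι| cubes, are polynomial, and hence survive limits; they fail for
2×2 matrix multiplication and for x₀x₁x₂, while every tensor of order three has flattening ranks at
most |ι|. Ternary cubics with k = 3 make both inclusions strict at once: x₀x₁x₂ for the second,
x₀²x₁ + x₂³ for the first, the latter having a nilpotent slice that Waring rank 3 forbids. -/

theorem iInf_natCast_le_iff {α : Sort*} (p : α → Prop) (f : α → ℕ) (k : ℕ) :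
    (⨅ (a : α) (_ : p a), (f a : ℕ∞)) ≤ k ↔ ∃ a, p a ∧ f a ≤ k := by
  constructor
  · intro h
    by_contra! hne
    have h1 : ((k + 1 : ℕ) : ℕ∞) ≤ ⨅ (a : α) (_ : p a), (f a : ℕ∞) :=
      le_iInf₂ fun a ha => by exact_mod_cast hne a ha
    have h2 := h1.trans h
    norm_cast at h2
    omega
  · rintro ⟨a, ha, hk⟩
    exact (iInf₂_le a ha).trans (by exact_mod_cast hk)

variable {ι : Type} {d k : ℕ}

theorem pureTensor_zero (hd : 1 ≤ d) : pureTensor (fun _ : Fin d => (0 : ι → ℂ)) = 0 := by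
  funext i
  simp only [pureTensor, Pi.zero_apply]
  exact Finset.prod_eq_zero (Finset.mem_univ ⟨0, hd⟩) rfl

/-- Shorter decompositions are padded with zero vectors, whose d-th tensor power is 0 because d ≥ 1.
-/
theorem waringRank_le_iff (hd : 1 ≤ d) (T : Tensor ι d) :
    waringRank T ≤ k ↔ ∃ l : Fin k → ι → ℂ, T = ∑ a, pureTensor (fun _ => l a) := by
  rw [waringRank, iInf_natCast_le_iff (fun r => ∃ l : Fin r → ι → ℂ, T = ∑ a, pureTensor
    (fun _ => l a)) (fun r => r)]
  constructor
  · rintro ⟨r, ⟨l, rfl⟩, hr⟩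
    obtain ⟨s, rfl⟩ := Nat.exists_eq_add_of_le hr
    refine ⟨Fin.append l 0, ?_⟩
    simp [Fin.sum_univ_add, pureTensor_zero hd]
  · rintro ⟨l, h⟩
    exact ⟨k, ⟨l, h⟩, le_rfl⟩

theorem borderWaringRank_le_iff (T : Tensor ι d) :
    borderWaringRank T ≤ k ↔ T ∈ closure {S : Tensor ι d | waringRank S ≤ k} := by
  rw [borderWaringRank, iInf_natCast_le_iff
    (fun r : ℕ => T ∈ closure {S : Tensor ι d | waringRank S ≤ r}) (fun r => r)]
  constructor
  · rintro ⟨r, h, hr⟩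
    refine closure_mono ?_ h
    intro S (hS : waringRank S ≤ r)
    exact le_trans hS (by exact_mod_cast hr)
  · intro h
    exact ⟨k, h, le_rfl⟩

theorem borderNcw_le_iff (T : Tensor ι d) :
    borderNcw T ≤ k ↔ T ∈ closure {S : Tensor ι d | ncw S ≤ k} := by
  rw [borderNcw, iInf_natCast_le_iff
    (fun r : ℕ => T ∈ closure {S : Tensor ι d | ncw S ≤ r}) (fun r => r)]
  constructor
  · rintro ⟨r, h, hr⟩
    refine closure_mono ?_ h
    intro S (hS : ncw S ≤ r)
    exact le_trans hS (by exact_mod_cast hr)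
  · intro h
    exact ⟨k, h, le_rfl⟩

theorem ncw_le_iff (T : Tensor ι d) :
    ncw T ≤ k ↔ ∃ A : NcABP ι d, A.tensor = T ∧ A.width ≤ k :=
  iInf_natCast_le_iff (fun A : NcABP ι d => A.tensor = T) NcABP.width k

/-! ### Tensors as functions on words, and their flattenings -/

/-- A tensor of order `d` as a function on words that vanishes outside the words of length `d`. -/
def onWords (T : Tensor ι d) (w : List ι) : ℂ :=
  if h : w.length = d then T (fun j => w.get (j.cast h.symm)) else 0

theorem onWords_eq (T : Tensor ι d) (F : List ι → ℂ) (h : ∀ i, T i = F (List.ofFn i))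
    (w : List ι) : onWords T w = if w.length = d then F w else 0 := by
  unfold onWords
  split_ifs with hw
  · subst hw
    rw [h]
    simp
  · rfl

theorem onWords_ofFn (T : Tensor ι d) (i : Fin d → ι) : onWords T (List.ofFn i) = T i := by
  simp [onWords]

theorem continuous_onWords (w : List ι) : Continuous fun T : Tensor ι d => onWords T w := by
  unfold onWords
  split_ifs
  · exact continuous_apply _
  · exact continuous_const

/-- The column with index `w` of the flattening of `T` after `j` factors. -/
def col (T : Tensor ι d) (j : ℕ) (w : List ι) : (Fin j → ι) → ℂ :=
  fun u => onWords T (List.ofFn u ++ w)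

theorem ofFn_snoc {α : Type*} {n : ℕ} (u : Fin n → α) (x : α) :
    List.ofFn (Fin.snoc u x : Fin (n + 1) → α) = List.ofFn u ++ [x] := by
  rw [List.ofFn_succ']
  simp

/-- Moving one letter across the cut: this relation between consecutive flattenings later yields the
edge labels of a program. -/
theorem col_snoc (T : Tensor ι d) (j : ℕ) (w : List ι) (u : Fin j → ι) (x : ι) :
    col T (j + 1) w (Fin.snoc u x) = col T j (x :: w) u := by
  rw [col, ofFn_snoc, List.append_assoc]
  rfl

theorem col_eq_zero (T : Tensor ι d) {j : ℕ} {w : List ι} (h : j + w.length ≠ d) :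
    col T j w = 0 := by
  funext u
  simp [col, onWords, h]

/-- All the proper flattenings of `T` have rank at most `k`. -/
def FlatteningRankLE (k : ℕ) (T : Tensor ι d) : Prop :=
  ∀ j, 0 < j → j < d → ∀ w : Fin (k + 1) → List ι, ¬ LinearIndependent ℂ fun a => col T j (w a)

/-- Independence of k + 1 given columns is an open condition on T, so the rank bound is an
intersection of closed conditions. -/
theorem isClosed_flatteningRankLE [Fintype ι] (k d : ℕ) :
    IsClosed {T : Tensor ι d | FlatteningRankLE k T} := by
  simp only [FlatteningRankLE, Set.ofPred_forall]
  refine isClosed_iInter fun j => isClosed_iInter fun _ => isClosed_iInter fun _ =>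
    isClosed_iInter fun w => ?_
  have h : IsOpen {f : Fin (k + 1) → (Fin j → ι) → ℂ | LinearIndependent ℂ f} :=
    isOpen_setOfPred_linearIndependent
  have hc : Continuous fun (T : Tensor ι d) (a : Fin (k + 1)) => col T j (w a) :=
    continuous_pi fun a => continuous_pi fun u => continuous_onWords _
  exact (h.preimage hc).isClosed_compl

theorem flatteningRankLE_of_forall_span {T : Tensor ι d}
    (h : ∀ j, 0 < j → j < d → ∃ s : Finset ((Fin j → ι) → ℂ), s.card ≤ k ∧
      ∀ w, col T j w ∈ Submodule.span ℂ (s : Set ((Fin j → ι) → ℂ))) :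
    FlatteningRankLE k T := by
  intro j h0 hj w hli
  obtain ⟨s, hs, hw⟩ := h j h0 hj
  have := linearIndependent_le_span_aux' _ hli (s : Set ((Fin j → ι) → ℂ))
    (by rintro _ ⟨a, rfl⟩; exact hw _)
  simp at this
  omega

theorem exists_fin_span_of_not_linearIndependent {α E : Type*} [AddCommGroup E] [Module ℂ E]
    (f : α → E) (k : ℕ) (h : ∀ w : Fin (k + 1) → α, ¬ LinearIndependent ℂ fun a => f (w a)) :
    ∃ b : Fin k → E, (∀ a, b a ∈ Submodule.span ℂ (Set.range f)) ∧
      ∀ x, f x ∈ Submodule.span ℂ (Set.range b) := by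
  obtain ⟨s, hs, hspan, hli⟩ := exists_linearIndependent ℂ (Set.range f)
  have key : ¬ ∃ g : Fin (k + 1) → s, Function.Injective g := by
    rintro ⟨g, hg⟩
    have h1 := hli.comp g hg
    choose w hw using fun a => hs (g a).2
    refine h w ?_
    have h2 : (fun a => f (w a)) = Subtype.val ∘ g := funext hw
    rw [h2]
    exact h1
  have hfin : s.Finite := by
    by_contra hinf
    have : Infinite s := Set.infinite_coe_iff.mpr hinf
    exact key ⟨fun a => Infinite.natEmbedding s a, fun a b hab =>
      Fin.ext ((Infinite.natEmbedding s).injective hab)⟩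
  have := hfin.fintype
  have hcard : Fintype.card s ≤ k := by
    by_contra! hc
    exact key ⟨fun a => (Fintype.equivFin s).symm (Fin.castLE hc a), fun a b hab => by
      simpa using hab⟩
  -- A maximal independent subfamily has at most k members; the remaining places are filled with 0.
  refine ⟨Function.extend (Fin.castLE hcard) (fun a => ((Fintype.equivFin s).symm a : E)) 0,
    ?_, ?_⟩
  · intro a
    by_cases ha : ∃ c, Fin.castLE hcard c = a
    · obtain ⟨c, rfl⟩ := ha
      rw [(Fin.castLE_injective hcard).extend_apply]
      exact Submodule.subset_span (hs (Subtype.coe_prop _))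
    · rw [Function.extend_apply' _ _ _ ha]
      exact Submodule.zero_mem _
  · intro x
    have hx : f x ∈ Submodule.span ℂ s := hspan ▸ Submodule.subset_span ⟨x, rfl⟩
    refine Submodule.span_mono ?_ hx
    intro y hy
    refine ⟨Fin.castLE hcard (Fintype.equivFin s ⟨y, hy⟩), ?_⟩
    rw [(Fin.castLE_injective hcard).extend_apply]
    simp

/-- Since ℓ^{⊗d} = ℓ^{⊗j} ⊗ ℓ^{⊗(d-j)}, every column is a combination of the k tensors ℓ_a^{⊗j}. -/
theorem flatteningRankLE_of_waringRank_le (hd : 1 ≤ d) {T : Tensor ι d} (h : waringRank T ≤ k) :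
    FlatteningRankLE k T := by
  classical
  obtain ⟨l, hl⟩ := (waringRank_le_iff hd T).1 h
  have hT : ∀ i, T i = ∑ a, ((List.ofFn i).map (l a)).prod := by
    intro i
    simp [hl, pureTensor, List.map_ofFn, List.prod_ofFn]
  refine flatteningRankLE_of_forall_span fun j _ _ =>
    ⟨Finset.univ.image fun a (u : Fin j → ι) => ((List.ofFn u).map (l a)).prod,
      Finset.card_image_le.trans (by simp), fun w => ?_⟩
  by_cases hw : j + w.length = d
  · have : col T j w = ∑ a, (w.map (l a)).prod •
        fun u : Fin j → ι => ((List.ofFn u).map (l a)).prod := by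
      funext u
      rw [col, onWords_eq T (fun v => ∑ a, (v.map (l a)).prod) hT]
      simp [hw, mul_comm]
    rw [this]
    refine Submodule.sum_mem _ fun a _ => Submodule.smul_mem _ _ (Submodule.subset_span ?_)
    simp
  · rw [col_eq_zero T hw]
    exact Submodule.zero_mem _

/-! ### Transfer matrices of a branching program -/

theorem prod_ofFn_matrix_apply {V : Type*} [Fintype V] [DecidableEq V] {n : ℕ}
    (M : Fin n → Matrix V V ℂ) (s t : V) :
    (List.ofFn M).prod s t = ∑ P : Fin (n + 1) → V,
      if P 0 = s ∧ P (Fin.last n) = t then ∏ j, M j (P j.castSucc) (P j.succ) else 0 := by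
  induction n generalizing t with
  | zero =>
    rw [← (Equiv.funUnique (Fin 1) V).symm.sum_comp]
    simp [Matrix.one_apply, ite_and]
  | succ n ih =>
    rw [List.ofFn_succ', List.concat_eq_append, List.prod_append, List.prod_singleton,
      Matrix.mul_apply, ← (Fin.snocEquiv fun _ => V).sum_comp, Fintype.sum_prod_type]
    have h1 : ∀ (x : V) (P : Fin (n + 1) → V),
        (Fin.snoc P x : Fin (n + 2) → V) 0 = P 0 := fun x P => by
      rw [← Fin.castSucc_zero, Fin.snoc_castSucc]
    have h2 : ∀ (x : V) (P : Fin (n + 1) → V) (j : Fin n),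
        (Fin.snoc P x : Fin (n + 2) → V) j.castSucc.succ = P j.succ := fun x P j => by
      rw [Fin.succ_castSucc, Fin.snoc_castSucc]
    simp only [Fin.snocEquiv, Equiv.coe_fn_mk, h1, Fin.snoc_last, Fin.prod_univ_castSucc,
      Fin.snoc_castSucc, h2, Fin.succ_last]
    simp only [ih, Finset.sum_mul]
    rw [Finset.sum_comm]
    conv_rhs => rw [Finset.sum_comm]
    refine Finset.sum_congr rfl fun P _ => ?_
    by_cases hs : P 0 = s <;> simp [hs]

open Classical in
/-- The transfer matrix of the letter `x`. -/
def NcABP.transfer (A : NcABP ι d) (x : ι) : Matrix A.Vert A.Vert ℂ :=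
  fun u v => if A.graph.Adj u v then A.label u v x else 0

open Classical in
theorem NcABP.tensor_apply (A : NcABP ι d) (i : Fin d → ι) :
    A.tensor i = ((List.ofFn i).map A.transfer).prod A.source A.sink := by
  rw [List.map_ofFn, prod_ofFn_matrix_apply, NcABP.tensor, Finset.sum_filter, Finset.sum_apply]
  refine Finset.sum_congr rfl fun P _ => ?_
  by_cases h : P 0 = A.source ∧ P (Fin.last d) = A.sink
  · by_cases h' : ∀ j : Fin d, A.graph.Adj (P j.castSucc) (P j.succ)
    · simp [NcABP.IsPath, h, h', pureTensor, NcABP.transfer]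
    · have : ¬ A.IsPath P := fun hp => h' hp.2.2
      rw [if_neg this, if_pos h]
      push Not at h'
      obtain ⟨j, hj⟩ := h'
      exact (Finset.prod_eq_zero (Finset.mem_univ j) (by simp [NcABP.transfer, hj])).symm
  · have : ¬ A.IsPath P := fun hp => h ⟨hp.1, hp.2.1⟩
    rw [if_neg this, if_neg h]
    rfl

open Classical in
theorem NcABP.layer_eq_of_prod_transfer_ne_zero (A : NcABP ι d) (w : List ι) (u v : A.Vert)
    (h : (w.map A.transfer).prod u v ≠ 0) : A.layer v = A.layer u + w.length := by
  induction w generalizing u with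
  | nil =>
    have : u = v := by
      by_contra hne
      simp [hne] at h
    simp [this]
  | cons x w ih =>
    rw [List.map_cons, List.prod_cons, Matrix.mul_apply] at h
    obtain ⟨y, _, hy⟩ := Finset.exists_ne_zero_of_sum_ne_zero h
    have h1 : A.graph.Adj u y := by
      by_contra hn
      simp [NcABP.transfer, hn] at hy
    rw [ih y (right_ne_zero_of_mul hy), A.layer_adj u y h1, List.length_cons]
    omega

theorem NcABP.card_layer_le_width (A : NcABP ι d) (n : ℕ) :
    (Finset.univ.filter fun u => A.layer u = n).card ≤ A.width := by
  by_cases h : ∃ v, A.layer v = n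
  · obtain ⟨v, rfl⟩ := h
    exact Finset.le_sup (f := fun v => (Finset.univ.filter fun u => A.layer u = A.layer v).card)
      (Finset.mem_univ v)
  · push Not at h
    simp [h]

/-- Every source-sink path crosses layer j at one vertex, so the columns are combinations of the
path sums from the source to the vertices of that layer. -/
theorem flatteningRankLE_of_ncw_le {T : Tensor ι d} (h : ncw T ≤ k) : FlatteningRankLE k T := by
  classical
  obtain ⟨A, rfl, hA⟩ := (ncw_le_iff T).1 h
  refine flatteningRankLE_of_forall_span fun j _ _ =>
    ⟨(Finset.univ.filter fun v => A.layer v = A.layer A.source + j).image fun v (u : Fin j → ι) =>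
      ((List.ofFn u).map A.transfer).prod A.source v,
      Finset.card_image_le.trans ((A.card_layer_le_width _).trans hA), fun w => ?_⟩
  by_cases hw : j + w.length = d
  · have : col A.tensor j w = ∑ v, (w.map A.transfer).prod v A.sink •
        fun u : Fin j → ι => ((List.ofFn u).map A.transfer).prod A.source v := by
      funext u
      rw [col, onWords_eq A.tensor (fun v => (v.map A.transfer).prod A.source A.sink)
        A.tensor_apply]
      simp [hw, Matrix.mul_apply, mul_comm]
    rw [this]
    refine Submodule.sum_mem _ fun v _ => Submodule.smul_mem _ _ ?_
    by_cases hv : A.layer v = A.layer A.source + j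
    · exact Submodule.subset_span (by
        simp only [Finset.coe_image, Set.mem_image]
        exact ⟨v, by simpa using hv, rfl⟩)
    · have h0 : (fun u : Fin j → ι => ((List.ofFn u).map A.transfer).prod A.source v) = 0 := by
        funext u
        by_contra hne
        exact hv (by simpa using A.layer_eq_of_prod_transfer_ne_zero _ _ _ hne)
      rw [h0]
      exact Submodule.zero_mem _
  · rw [col_eq_zero _ hw]
    exact Submodule.zero_mem _

/-! ### Nisan's construction of a program from flattening ranks -/

/-- The branching program with `d + 1` layers of `k` vertices each and labels `M`. -/
def gridABP (hk : 0 < k) (M : ℕ → ι → Fin k → Fin k → ℂ) : NcABP ι d where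
  Vert := Fin (d + 1) × Fin k
  graph := { Adj := fun u v => (v.1 : ℕ) = u.1 + 1 }
  layer := fun u => u.1
  layer_adj := fun _ _ h => h
  source := (0, ⟨0, hk⟩)
  sink := (Fin.last d, ⟨0, hk⟩)
  layer_sink := by simp
  label := fun u v x => M u.1 x u.2 v.2

theorem gridABP_width_le (hk : 0 < k) (M : ℕ → ι → Fin k → Fin k → ℂ) :
    (gridABP (d := d) hk M).width ≤ k := by
  refine Finset.sup_le fun v _ => ?_
  have : (Finset.univ.filter fun u : Fin (d + 1) × Fin k => (u.1 : ℕ) = v.1) ⊆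
      Finset.univ.image fun c : Fin k => (v.1, c) := by
    rintro ⟨a, c⟩ h
    simp only [Finset.mem_filter, Finset.mem_univ, true_and] at h
    simp [Fin.ext h]
  calc _ ≤ _ := Finset.card_le_card this
    _ ≤ _ := Finset.card_image_le
    _ = k := by simp

/-- The transfer matrices of `gridABP`. -/
def gridMatrix (d : ℕ) (M : ℕ → ι → Fin k → Fin k → ℂ) (x : ι) :
    Matrix (Fin (d + 1) × Fin k) (Fin (d + 1) × Fin k) ℂ :=
  fun u v => if (v.1 : ℕ) = u.1 + 1 then M u.1 x u.2 v.2 else 0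

/-- Here `b j a u` is the total weight of the paths reading `u` from the source to vertex `a` of
layer `j`; `hM` is the recursion on the last letter. -/
theorem gridMatrix_prod_apply [DecidableEq (Fin (d + 1) × Fin k)] (hk : 0 < k)
    (M : ℕ → ι → Fin k → Fin k → ℂ)
    (b : ∀ j, Fin k → (Fin j → ι) → ℂ) (h0 : ∀ c u, b 0 c u = if c = ⟨0, hk⟩ then 1 else 0)
    (hM : ∀ j < d, ∀ a x u, b (j + 1) a (Fin.snoc u x) = ∑ c, M j x c a * b j c u)
    (n : ℕ) (hn : n ≤ d) (u : Fin n → ι) (p : Fin (d + 1)) (a : Fin k) :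
    ((List.ofFn u).map (gridMatrix d M)).prod (0, ⟨0, hk⟩) (p, a) =
      if (p : ℕ) = n then b n a u else 0 := by
  induction n generalizing p a with
  | zero =>
    simp only [List.ofFn_zero, List.map_nil, List.prod_nil, h0]
    by_cases hp : p = 0
    · subst hp
      by_cases ha : a = ⟨0, hk⟩
      · subst ha
        simp
      · rw [Matrix.one_apply_ne (by simpa [Prod.ext_iff, eq_comm] using ha)]
        simp [ha]
    · rw [Matrix.one_apply_ne (fun h => hp (Prod.ext_iff.1 h).1.symm), if_neg]
      exact fun h => hp (Fin.ext h)
  | succ n ih =>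
    obtain ⟨x, u, rfl⟩ : ∃ (x : ι) (v : Fin n → ι), u = Fin.snoc v x :=
      ⟨u (Fin.last n), Fin.init u, (Fin.snoc_init_self u).symm⟩
    rw [ofFn_snoc, List.map_append, List.prod_append, List.map_singleton, List.prod_singleton,
      Matrix.mul_apply, Fintype.sum_prod_type, Finset.sum_eq_single (⟨n, by omega⟩ : Fin (d + 1))]
    · simp only [ih (by omega) u, if_true, hM n (by omega)]
      split_ifs with hp
      · refine Finset.sum_congr rfl fun c _ => ?_
        simp [gridMatrix, hp, mul_comm]
      · refine Finset.sum_eq_zero fun c _ => ?_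
        simp [gridMatrix, hp]
    · intro q _ hq
      refine Finset.sum_eq_zero fun c _ => ?_
      rw [ih (by omega) u, if_neg, zero_mul]
      intro h
      exact hq (Fin.ext h)
    · simp

/-- The vertices of layer j stand for a spanning family `b j` of the j-th column space. Restricting
to words ending in x maps the column space at j + 1 into the one at j, and the coefficients of this
map in the families `b` are the labels. -/
theorem ncw_le_of_flatteningRankLE (hk : 1 ≤ k) (hd : 1 ≤ d) {T : Tensor ι d}
    (h : FlatteningRankLE k T) : ncw T ≤ k := by
  classical
  have hb : ∀ j, ∃ b : Fin k → (Fin j → ι) → ℂ,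
      (j = 0 → ∀ c u, b c u = if c = ⟨0, hk⟩ then 1 else 0) ∧
      (j = d → ∀ c, b c = col T j []) ∧
      (0 < j → j ≤ d → ∀ a, b a ∈ Submodule.span ℂ (Set.range (col T j))) ∧
      (j < d → ∀ w, col T j w ∈ Submodule.span ℂ (Set.range b)) := by
    intro j
    rcases Nat.eq_zero_or_pos j with rfl | h0
    · refine ⟨fun c _ => if c = ⟨0, hk⟩ then 1 else 0, fun _ _ _ => rfl, by omega, by omega,
        fun _ w => ?_⟩
      have : col T 0 w = col T 0 w Fin.elim0 •
          fun _ : Fin 0 → ι => if (⟨0, hk⟩ : Fin k) = ⟨0, hk⟩ then (1 : ℂ) else 0 := by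
        funext u
        simp [Subsingleton.elim u Fin.elim0]
      rw [this]
      exact Submodule.smul_mem _ _ (Submodule.subset_span ⟨_, rfl⟩)
    · by_cases hj : j < d
      · obtain ⟨b, h1, h2⟩ := exists_fin_span_of_not_linearIndependent (col T j) k (h j h0 hj)
        exact ⟨b, by omega, by omega, fun _ _ => h1, fun _ => h2⟩
      -- At layer d every vertex carries T itself, so any of them may be the sink.
      · exact ⟨fun _ => col T j [], by omega, fun _ _ => rfl,
          fun _ _ _ => Submodule.subset_span ⟨_, rfl⟩, by omega⟩
  choose b b0 bd b1 b2 using hb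
  have hM : ∀ (j : ℕ) (x : ι) (a : Fin k), ∃ m : Fin k → ℂ, j < d →
      ∀ u, b (j + 1) a (Fin.snoc u x) = ∑ c, m c * b j c u := by
    intro j x a
    by_cases hj : j < d
    · have h1 : ∀ v ∈ Submodule.span ℂ (Set.range (col T (j + 1))),
          (fun u : Fin j → ι => v (Fin.snoc u x)) ∈ Submodule.span ℂ (Set.range (b j)) := by
        intro v hv
        have hle : Submodule.span ℂ (Set.range (col T (j + 1))) ≤
            (Submodule.span ℂ (Set.range (b j))).comap
              (LinearMap.funLeft ℂ ℂ fun u : Fin j → ι => (Fin.snoc u x : Fin (j + 1) → ι)) := by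
          rw [Submodule.span_le]
          rintro _ ⟨w, rfl⟩
          have : LinearMap.funLeft ℂ ℂ (fun u : Fin j → ι => (Fin.snoc u x : Fin (j + 1) → ι))
              (col T (j + 1) w) = col T j (x :: w) := by
            funext u
            exact col_snoc T j w u x
          simp only [Submodule.comap_coe, Set.mem_preimage, this]
          exact b2 j hj _
        exact hle hv
      obtain ⟨m, hm⟩ := (Submodule.mem_span_range_iff_exists_fun ℂ).1
        (h1 _ (b1 (j + 1) (by omega) hj a))
      refine ⟨m, fun _ u => ?_⟩
      simpa using (congrFun hm u).symm
    · exact ⟨0, fun hj' => absurd hj' hj⟩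
  choose M hM using hM
  refine (ncw_le_iff T).2 ⟨gridABP hk fun j x c a => M j x a c, ?_, gridABP_width_le hk _⟩
  funext i
  rw [NcABP.tensor_apply]
  have := @gridMatrix_prod_apply ι d k (fun _ _ => Classical.propDecidable _) hk
    (fun j x c a => M j x a c) b (b0 0 rfl)
    (fun j hj a x u => hM j x a hj u) d le_rfl i (Fin.last d) ⟨0, hk⟩
  rw [Fin.val_last, if_pos rfl, bd d rfl, col, List.append_nil, onWords_ofFn] at this
  have ht : (gridABP (d := d) hk fun j x c a => M j x a c).transfer =
      gridMatrix d fun j x c a => M j x a c := by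
    funext x u v
    exact if_congr Iff.rfl rfl rfl
  rw [ht]
  exact this

/-! ### The inclusions and the closedness of `B` -/

theorem flatteningRankLE_of_borderWaringRank_le [Fintype ι] (hd : 1 ≤ d) {T : Tensor ι d}
    (h : borderWaringRank T ≤ k) : FlatteningRankLE k T :=
  closure_minimal (fun _ hS => flatteningRankLE_of_waringRank_le hd hS)
    (isClosed_flatteningRankLE k d) ((borderWaringRank_le_iff T).1 h)

theorem flatteningRankLE_of_borderNcw_le [Fintype ι] {T : Tensor ι d}
    (h : borderNcw T ≤ k) : FlatteningRankLE k T :=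
  closure_minimal (fun _ hS => flatteningRankLE_of_ncw_le hS)
    (isClosed_flatteningRankLE k d) ((borderNcw_le_iff T).1 h)

theorem W_subset_WBar (ι : Type) (k d : ℕ) : W ι k d ⊆ WBar ι k d :=
  fun _ h => ⟨h.1, (borderWaringRank_le_iff _).2 (subset_closure h.2)⟩

theorem WBar_subset_B [Fintype ι] (hk : 1 ≤ k) (hd : 1 ≤ d) : WBar ι k d ⊆ B ι k d :=
  fun _ h => ⟨h.1, ncw_le_of_flatteningRankLE hk hd (flatteningRankLE_of_borderWaringRank_le hd h.2)⟩

theorem B_eq_BBar [Fintype ι] (hk : 1 ≤ k) (hd : 1 ≤ d) : B ι k d = BBar ι k d :=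
  Set.Subset.antisymm (fun _ h => ⟨h.1, (borderNcw_le_iff _).2 (subset_closure h.2)⟩)
    fun _ h => ⟨h.1, ncw_le_of_flatteningRankLE hk hd (flatteningRankLE_of_borderNcw_le h.2)⟩

/-- A tensor of order three over `ℂ^ι` with `|ι| ≤ k` has flattening ranks at most `k`. -/
theorem flatteningRankLE_of_card_le [Fintype ι] (hk : Fintype.card ι ≤ k) (T : Tensor ι 3) :
    FlatteningRankLE k T := by
  classical
  refine flatteningRankLE_of_forall_span fun j h0 h3 => ?_
  obtain rfl | rfl : j = 1 ∨ j = 2 := by omega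
  · refine ⟨Finset.univ.image fun x (u : Fin 1 → ι) => if u 0 = x then 1 else 0,
      Finset.card_image_le.trans (by simpa using hk), fun w => ?_⟩
    have : col T 1 w = ∑ x, col T 1 w (fun _ => x) •
        fun u : Fin 1 → ι => if u 0 = x then 1 else 0 := by
      funext u
      simp only [Finset.sum_apply, Pi.smul_apply, smul_eq_mul, mul_ite, mul_one, mul_zero,
        Finset.sum_ite_eq, Finset.mem_univ, if_true]
      congr 1
      funext i
      rw [Subsingleton.elim i 0]
    rw [this]
    exact Submodule.sum_mem _ fun x _ => Submodule.smul_mem _ _ (Submodule.subset_span (by simp))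
  · refine ⟨Finset.univ.image fun x => col T 2 [x],
      Finset.card_image_le.trans (by simpa using hk), fun w => ?_⟩
    by_cases hw : 2 + w.length = 3
    · obtain ⟨x, rfl⟩ := List.length_eq_one_iff.1 (by omega : w.length = 1)
      exact Submodule.subset_span (by simp)
    · rw [col_eq_zero T hw]
      exact Submodule.zero_mem _

theorem mem_B_of_card_le [Fintype ι] (hk : 1 ≤ k) (hc : Fintype.card ι ≤ k) {T : Tensor ι 3}
    (hT : IsSymm T) : T ∈ B ι k 3 :=
  ⟨hT, ncw_le_of_flatteningRankLE hk (by norm_num) (flatteningRankLE_of_card_le hc T)⟩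

/-! ### Symmetric tensors -/

theorem isSymm_symProd (v : Fin d → ι → ℂ) : IsSymm (symProd v) := by
  intro τ i
  simp only [symProd, Pi.smul_apply, Finset.sum_apply, pureTensor, Function.comp_apply]
  congr 1
  rw [← Equiv.sum_comp (Equiv.mulRight τ)]
  refine Finset.sum_congr rfl fun σ _ => ?_
  exact Equiv.prod_comp τ fun j => v (σ j) (i j)

theorem isSymm_pureTensor (v : ι → ℂ) : IsSymm (pureTensor fun _ : Fin d => v) :=
  fun τ i => Equiv.prod_comp τ fun j => v (i j)

theorem IsSymm.add {S T : Tensor ι d} (hS : IsSymm S) (hT : IsSymm T) : IsSymm (S + T) :=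
  fun σ i => by simp [hS σ i, hT σ i]

theorem IsSymm.smul {T : Tensor ι d} (c : ℂ) (hT : IsSymm T) : IsSymm (c • T) :=
  fun σ i => by simp [hT σ i]

/-- The sum over σ does not depend on `a`; averaging over `a` gives the identity. -/
theorem sum_perm_apply (a : Fin d) (f : Fin d → ℂ) :
    (d : ℂ) * ∑ σ : Equiv.Perm (Fin d), f (σ a) = d.factorial * ∑ j, f j := by
  have h : ∀ b, ∑ σ : Equiv.Perm (Fin d), f (σ b) = ∑ σ : Equiv.Perm (Fin d), f (σ a) := by
    intro b
    rw [← Equiv.sum_comp (Equiv.mulRight (Equiv.swap a b))]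
    simp
  have h1 : ∑ b, ∑ σ : Equiv.Perm (Fin d), f (σ b) =
      (d : ℂ) * ∑ σ : Equiv.Perm (Fin d), f (σ a) := by
    simp [h]
  rw [← h1, Finset.sum_comm]
  simp [fun σ : Equiv.Perm (Fin d) => Equiv.sum_comp σ f, Fintype.card_perm]

/-- The symmetric product `b ⊙ a ⊙ ⋯ ⊙ a` in coordinates. -/
theorem symProd_ite_apply (hd : 1 ≤ d) (a b : ι → ℂ) (i : Fin d → ι) :
    symProd (fun j : Fin d => if (j : ℕ) = 0 then b else a) i =
      (d : ℂ)⁻¹ * ∑ j, (∏ l ∈ Finset.univ.erase j, a (i l)) * b (i j) := by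
  set f : Fin d → ℂ := fun j => (∏ l ∈ Finset.univ.erase j, a (i l)) * b (i j) with hf
  -- The summand depends on σ only through the position where `b` lands.
  have h : ∀ σ : Equiv.Perm (Fin d),
      ∏ j, (if (σ j : ℕ) = 0 then b else a) (i j) = f (σ⁻¹ ⟨0, hd⟩) := by
    intro σ
    rw [hf, ← Finset.prod_erase_mul _ _ (Finset.mem_univ (σ⁻¹ ⟨0, hd⟩))]
    congr 1
    · refine Finset.prod_congr rfl fun l hl => ?_
      rw [if_neg]
      intro h0
      refine (Finset.mem_erase.1 hl).1 ?_
      rw [Equiv.Perm.eq_inv_iff_eq]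
      exact Fin.ext h0
    · simp
  have h1 := sum_perm_apply ⟨0, hd⟩ f
  rw [← Equiv.sum_comp (Equiv.inv (Equiv.Perm (Fin d)))] at h1
  simp only [symProd, Pi.smul_apply, Finset.sum_apply, pureTensor, h, smul_eq_mul]
  simp only [Equiv.inv_apply] at h1
  have hd0 : (d : ℂ) ≠ 0 := by exact_mod_cast (by omega : d ≠ 0)
  have hf0 : (d.factorial : ℂ) ≠ 0 := by exact_mod_cast d.factorial_ne_zero
  rw [inv_mul_eq_iff_eq_mul₀ hf0, mul_left_comm, ← h1]
  field_simp

/-! ### Border Waring rank of monomials -/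

theorem exists_smul_pureTensor (hd : 1 ≤ d) (c : ℂ) (v : ι → ℂ) :
    ∃ u : ι → ℂ, pureTensor (fun _ : Fin d => u) = c • pureTensor fun _ => v := by
  obtain ⟨z, hz⟩ := IsAlgClosed.exists_pow_nat_eq c (n := d) hd
  refine ⟨z • v, ?_⟩
  funext i
  simp [pureTensor, Finset.prod_mul_distrib, hz]

/-- The derivative of (a + tb)^{⊗d} at t = 0 is d times this symmetric product, and each difference
quotient is a combination of two powers, whose coefficients are absorbed by d-th roots. -/
theorem borderWaringRank_symProd_le (hd : 1 ≤ d) (hk : 2 ≤ k) (a b : ι → ℂ) :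
    borderWaringRank (symProd (fun j : Fin d => if (j : ℕ) = 0 then b else a)) ≤ k := by
  have h2 : borderWaringRank (symProd (fun j : Fin d => if (j : ℕ) = 0 then b else a)) ≤
      (2 : ℕ) := by
    rw [borderWaringRank_le_iff]
    have ht : Filter.Tendsto (fun t : ℂ => (((d : ℂ)⁻¹ * t⁻¹) • pureTensor (fun _ : Fin d =>
        a + t • b) + (-((d : ℂ)⁻¹ * t⁻¹)) • pureTensor (fun _ : Fin d => a) : Tensor ι d))
        (𝓝[≠] 0) (𝓝 (symProd (fun j : Fin d => if (j : ℕ) = 0 then b else a))) := by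
      rw [tendsto_pi_nhds]
      intro i
      have hder : HasDerivAt (fun t : ℂ => ∏ j, (a (i j) + t * b (i j)))
          (∑ j, (∏ l ∈ Finset.univ.erase j, (a (i l) + 0 * b (i l))) • b (i j)) 0 :=
        HasDerivAt.fun_finsetProd fun j _ => by
          simpa using ((hasDerivAt_id (0 : ℂ)).mul_const (b (i j))).const_add (a (i j))
      have := (hasDerivAt_iff_tendsto_slope_zero.1 hder).const_mul (d : ℂ)⁻¹
      rw [symProd_ite_apply hd]
      simp only [zero_mul, add_zero, smul_eq_mul, zero_add] at this
      refine this.congr fun t => ?_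
      simp only [pureTensor, Pi.add_apply, Pi.smul_apply, smul_eq_mul]
      ring
    refine mem_closure_of_tendsto ht (Filter.Eventually.of_forall fun t => ?_)
    obtain ⟨u, hu⟩ := exists_smul_pureTensor hd ((d : ℂ)⁻¹ * t⁻¹) (a + t • b)
    obtain ⟨v, hv⟩ := exists_smul_pureTensor hd (-((d : ℂ)⁻¹ * t⁻¹)) a
    refine (waringRank_le_iff hd _).2 ⟨![u, v], ?_⟩
    rw [← hu, ← hv]
    simp [Fin.sum_univ_two]
  exact h2.trans (by exact_mod_cast hk)

/-! ### Waring rank of monomials -/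

/-- The apolar form is X ∏ (α_a X − β_a) over the a with β_a ≠ 0, homogenised to degree d ≥ k + 1.
It vanishes at every (α_a, β_a), the factor X taking care of β_a = 0, and its linear coefficient is
∏ (−β_a) ≠ 0. -/
theorem sum_prod_vanishing_polynomial (hk : k < d) (α β : Fin k → ℂ) :
    ∃ q : Polynomial ℂ, q.coeff 1 ≠ 0 ∧
      ∀ a, ∑ s ∈ Finset.range (d + 1), q.coeff s * (β a ^ s * α a ^ (d - s)) = 0 := by
  set f : Fin k → Polynomial ℂ := fun a =>
    if β a = 0 then 1 else Polynomial.C (α a) * Polynomial.X - Polynomial.C (β a) with hf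
  have hdeg1 : ∀ a, (f a).natDegree ≤ 1 := by
    intro a
    simp only [hf]
    split_ifs
    · simp
    · compute_degree
  have hdeg : (∏ a, f a).natDegree ≤ ∑ a, (f a).natDegree := Polynomial.natDegree_prod_le _ _
  refine ⟨Polynomial.X * ∏ a, f a, ?_, fun a => ?_⟩
  · rw [show (1 : ℕ) = 0 + 1 from rfl, Polynomial.coeff_X_mul, Polynomial.coeff_zero_eq_eval_zero,
      Polynomial.eval_prod, Finset.prod_ne_zero_iff]
    intro a _
    simp only [hf]
    split_ifs with h
    · simp
    · simpa using h
  · by_cases hβ : β a = 0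
    · refine Finset.sum_eq_zero fun s _ => ?_
      rcases Nat.eq_zero_or_pos s with rfl | hs
      · simp
      · simp [hβ, hs.ne']
    -- Point at infinity: its factor is constant, so the degree is at most k < d and the coefficient
    -- at d vanishes.
    by_cases hα : α a = 0
    · have hfa : (f a).natDegree = 0 := by
        simp [hf, hβ, hα]
      have hsum : ∑ c, (f c).natDegree < k := by
        calc ∑ c, (f c).natDegree < ∑ _c : Fin k, 1 :=
              Finset.sum_lt_sum (fun c _ => hdeg1 c) ⟨a, Finset.mem_univ _, by omega⟩
          _ = k := by simp
      refine Finset.sum_eq_zero fun s hs => ?_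
      rcases (Nat.lt_succ_iff.1 (Finset.mem_range.1 hs)).lt_or_eq with h | rfl
      · simp [hα, (Nat.sub_pos_of_lt h).ne']
      · rw [Polynomial.coeff_eq_zero_of_natDegree_lt, zero_mul]
        refine lt_of_le_of_lt Polynomial.natDegree_mul_le ?_
        rw [Polynomial.natDegree_X]
        omega
    · have hsum : ∑ c, (f c).natDegree ≤ k := by
        calc ∑ c, (f c).natDegree ≤ ∑ _c : Fin k, 1 := Finset.sum_le_sum fun c _ => hdeg1 c
          _ = k := by simp
      have hn : (Polynomial.X * ∏ a, f a).natDegree < d + 1 := by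
        refine lt_of_le_of_lt Polynomial.natDegree_mul_le ?_
        rw [Polynomial.natDegree_X]
        omega
      have he : (Polynomial.X * ∏ a, f a).eval (β a / α a) = 0 := by
        rw [Polynomial.eval_mul, Polynomial.eval_prod, Finset.prod_eq_zero (Finset.mem_univ a),
          mul_zero]
        simp only [hf, hβ, if_false, Polynomial.eval_sub, Polynomial.eval_mul, Polynomial.eval_C,
          Polynomial.eval_X]
        field_simp
        simp
      rw [Polynomial.eval_eq_sum_range' hn] at he
      rw [← mul_zero (α a ^ d), ← he, Finset.mul_sum]
      refine Finset.sum_congr rfl fun s hs => ?_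
      have hs' : s ≤ d := Nat.lt_succ_iff.1 (Finset.mem_range.1 hs)
      rw [div_pow, ← Nat.sub_add_cancel hs', pow_add, Nat.add_sub_cancel]
      field_simp

theorem monomialTensor_apply_ite [DecidableEq ι] {x y : ι} (hxy : x ≠ y) (hd : 2 ≤ d) (s : ℕ)
    (hs : s ≤ d) :
    monomialTensor d x y (fun j => if (j : ℕ) < s then y else x) =
      if s = 1 then (d : ℂ)⁻¹ else 0 := by
  have hex : (e x : ι → ℂ) y = 0 := by simp [e, hxy.symm]
  have hey : (e y : ι → ℂ) x = 0 := by simp [e, hxy]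
  rw [monomialTensor, symProd_ite_apply (by omega)]
  split_ifs with h1
  · subst h1
    rw [Finset.sum_eq_single (⟨0, by omega⟩ : Fin d)]
    · rw [Finset.prod_eq_one]
      · simp [e]
      · intro l hl
        have : (l : ℕ) ≠ 0 := fun h => (Finset.mem_erase.1 hl).1 (Fin.ext h)
        simp [e, this]
    · intro j _ hj
      have : (j : ℕ) ≠ 0 := fun h => hj (Fin.ext h)
      simp [this, hey]
    · simp
  · rw [Finset.sum_eq_zero, mul_zero]
    intro j _
    rcases Nat.eq_zero_or_pos s with rfl | h0
    · simp [hey]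
    · obtain ⟨l, hl, hls⟩ : ∃ l : Fin d, l ≠ j ∧ (l : ℕ) < s := by
        by_cases hj : (j : ℕ) = 0
        · exact ⟨⟨1, by omega⟩, by simp [Fin.ext_iff, hj], by simp; omega⟩
        · exact ⟨⟨0, by omega⟩, by simp [Fin.ext_iff]; omega, h0⟩
      rw [Finset.prod_eq_zero (Finset.mem_erase.2 ⟨hl, Finset.mem_univ l⟩), zero_mul]
      simp [hls, hex]

/-- Evaluate on the words y^s x^{d-s} and sum against the coefficients of q: all powers in a
decomposition vanish, while x^{d-1}y contributes only at s = 1. -/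
theorem not_waringRank_monomialTensor_le [DecidableEq ι] {x y : ι} (hxy : x ≠ y) (hk : k < d)
    (hd : 2 ≤ d) : ¬ waringRank (monomialTensor d x y) ≤ k := by
  intro h
  obtain ⟨l, hl⟩ := (waringRank_le_iff (by omega) _).1 h
  obtain ⟨q, hq1, hq⟩ := sum_prod_vanishing_polynomial hk (fun a => l a x) (fun a => l a y)
  have hc : ∀ s ∈ Finset.range (d + 1), q.coeff s * (if s = 1 then (d : ℂ)⁻¹ else 0) =
      ∑ a, q.coeff s * (l a y ^ s * l a x ^ (d - s)) := by
    intro s hs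
    have hs' : s ≤ d := Nat.lt_succ_iff.1 (Finset.mem_range.1 hs)
    rw [← monomialTensor_apply_ite hxy hd s hs', hl, Finset.sum_apply, Finset.mul_sum]
    refine Finset.sum_congr rfl fun a _ => ?_
    congr 1
    simp only [pureTensor]
    rw [Fin.prod_univ_eq_prod_range (fun j => l a (if j < s then y else x)) d,
      ← Nat.add_sub_cancel' hs', Finset.prod_range_add, Nat.add_sub_cancel_left]
    congr 1
    · rw [Finset.prod_congr rfl fun j hj => by rw [if_pos (Finset.mem_range.1 hj)]]
      simp
    · simp
  have h0 := Finset.sum_congr rfl hc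
  rw [Finset.sum_comm, Finset.sum_eq_zero fun a _ => hq a] at h0
  simp only [mul_ite, mul_zero, Finset.sum_ite_eq', Finset.mem_range] at h0
  rw [if_pos (by omega)] at h0
  have hd0 : (d : ℂ) ≠ 0 := by exact_mod_cast (by omega : d ≠ 0)
  exact mul_ne_zero hq1 (inv_ne_zero hd0) h0

theorem monomialTensor_mem [DecidableEq ι] {x y : ι} (hxy : x ≠ y) (hk : 2 ≤ k) (hkd : k < d) :
    monomialTensor d x y ∈ WBar ι k d \ W ι k d :=
  ⟨⟨isSymm_symProd _, borderWaringRank_symProd_le (by omega) hk _ _⟩,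
    fun h => not_waringRank_monomialTensor_le hxy hkd (by omega) h.2⟩

/-! ### Strassen's equations for cubics of minimal border rank -/

/-- The contraction of the first factor of `T` with `w`. -/
def slice [Fintype ι] (T : Tensor ι 3) (w : ι → ℂ) : Matrix ι ι ℂ :=
  fun j l => ∑ x, w x * T ![x, j, l]

theorem continuous_slice [Fintype ι] (w : ι → ℂ) : Continuous fun T : Tensor ι 3 => slice T w :=
  continuous_matrix fun j l =>
    continuous_finsetSum _ fun x _ => continuous_const.mul (continuous_apply ![x, j, l])

/-- With the ℓ_a as rows of L, which is square because there are |ι| of them, all slices are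
diagonalised by the same congruence. -/
theorem exists_slice_eq [Fintype ι] [DecidableEq ι] {T : Tensor ι 3}
    (h : waringRank T ≤ Fintype.card ι) :
    ∃ L : Matrix ι ι ℂ, ∀ w, slice T w = L.transpose * Matrix.diagonal (L.mulVec w) * L := by
  obtain ⟨l, rfl⟩ := (waringRank_le_iff (by norm_num) T).1 h
  refine ⟨Matrix.of fun a => l (Fintype.equivFin ι a), fun w => ?_⟩
  ext i j
  rw [Matrix.mul_apply]
  simp only [slice, Matrix.mul_diagonal, Matrix.of_apply, Matrix.transpose_apply, Matrix.mulVec,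
    dotProduct, Finset.sum_apply, pureTensor, Fin.prod_univ_three, Finset.mul_sum, Finset.sum_mul]
  rw [Finset.sum_comm, ← (Fintype.equivFin ι).sum_comp]
  refine Finset.sum_congr rfl fun a _ => Finset.sum_congr rfl fun x _ => ?_
  simp
  ring

/-- After the congruence this says that diagonal matrices commute. The adjugate replaces the inverse
so that the relation is polynomial in T and passes to limits. -/
theorem slice_mul_adjugate_mul_slice_of_waringRank_le [Fintype ι] [DecidableEq ι]
    {T : Tensor ι 3} (h : waringRank T ≤ Fintype.card ι) (u v w : ι → ℂ) :
    slice T u * (slice T w).adjugate * slice T v =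
      slice T v * (slice T w).adjugate * slice T u := by
  obtain ⟨L, hL⟩ := exists_slice_eq h
  have key : ∀ u v, slice T u * (slice T w).adjugate * slice T v = (L.det * L.det) •
      (L.transpose * (Matrix.diagonal (L.mulVec u) * (Matrix.diagonal (L.mulVec w)).adjugate *
        Matrix.diagonal (L.mulVec v)) * L) := by
    intro u v
    rw [hL, hL, hL, Matrix.adjugate_mul_distrib, Matrix.adjugate_mul_distrib]
    calc _ = L.transpose * Matrix.diagonal (L.mulVec u) * (L * L.adjugate) *
          (Matrix.diagonal (L.mulVec w)).adjugate * (L.transpose.adjugate * L.transpose) *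
          Matrix.diagonal (L.mulVec v) * L := by simp only [Matrix.mul_assoc]
      _ = _ := by
        rw [Matrix.mul_adjugate, Matrix.adjugate_mul, Matrix.det_transpose]
        simp only [Matrix.mul_smul, Matrix.smul_mul, Matrix.mul_one, smul_smul, Matrix.mul_assoc]
  rw [key, key]
  congr 3
  simp only [Matrix.adjugate_diagonal, Matrix.diagonal_mul_diagonal]
  congr 1
  funext a
  ring

theorem slice_mul_adjugate_mul_slice_of_borderWaringRank_le [Fintype ι] [DecidableEq ι]
    {T : Tensor ι 3} (h : borderWaringRank T ≤ Fintype.card ι) (u v w : ι → ℂ) :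
    slice T u * (slice T w).adjugate * slice T v =
      slice T v * (slice T w).adjugate * slice T u := by
  have hc : IsClosed {T : Tensor ι 3 | slice T u * (slice T w).adjugate * slice T v =
      slice T v * (slice T w).adjugate * slice T u} :=
    isClosed_eq
      (((continuous_slice u).matrix_mul (continuous_slice w).matrix_adjugate).matrix_mul
        (continuous_slice v))
      (((continuous_slice v).matrix_mul (continuous_slice w).matrix_adjugate).matrix_mul
        (continuous_slice u))
  exact closure_minimal
    (fun S hS => slice_mul_adjugate_mul_slice_of_waringRank_le (T := S) hS u v w) hc
    ((borderWaringRank_le_iff T).1 h)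

/-- Strassen's equations at an invertible slice. -/
theorem slice_mul_inv_mul_slice [Fintype ι] [DecidableEq ι] {T : Tensor ι 3}
    (h : borderWaringRank T ≤ Fintype.card ι) (u v w : ι → ℂ) {Q : Matrix ι ι ℂ}
    (hQ : slice T w * Q = 1) : slice T u * Q * slice T v = slice T v * Q * slice T u := by
  have h1 := slice_mul_adjugate_mul_slice_of_borderWaringRank_le h u v w
  have hadj : (slice T w).adjugate = (slice T w).det • Q := by
    rw [← Matrix.mul_one (slice T w).adjugate, ← hQ, ← Matrix.mul_assoc, Matrix.adjugate_mul,
      Matrix.smul_mul, Matrix.one_mul]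
  have hdet : (slice T w).det ≠ 0 := by
    intro h0
    have := congrArg Matrix.det hQ
    simp [h0] at this
  rw [hadj] at h1
  simp only [Matrix.mul_smul, Matrix.smul_mul] at h1
  exact smul_right_injective _ hdet h1

/-- At an invertible slice, a tensor of minimal Waring rank has no nilpotent directions. -/
theorem slice_eq_zero_of_mul_inv_mul_eq_zero [Fintype ι] [DecidableEq ι] {T : Tensor ι 3}
    (h : waringRank T ≤ Fintype.card ι) (v w : ι → ℂ) {Q : Matrix ι ι ℂ}
    (hQ : slice T w * Q = 1) (h0 : slice T v * Q * slice T v = 0) : slice T v = 0 := by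
  obtain ⟨L, hL⟩ := exists_slice_eq h
  set D := Matrix.diagonal (L.mulVec w)
  set E := Matrix.diagonal (L.mulVec v) with hE
  -- Invertibility of LᵀDL makes L and D invertible, with D⁻¹ = LQLᵀ. The hypothesis then becomes E
  -- D⁻¹ E = 0, hence E² = 0, hence E = 0 since E is diagonal.
  have h1 : D * L * Q * L.transpose = 1 := by
    rw [mul_eq_one_comm, ← hQ, hL w]
    simp only [Matrix.mul_assoc, D]
  have h1t : L * (D * L * Q).transpose = 1 := by
    have := congrArg Matrix.transpose h1
    rwa [Matrix.transpose_mul, Matrix.transpose_transpose, Matrix.transpose_one] at this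
  have h2 : L * Q * L.transpose * D = 1 := by
    rw [mul_eq_one_comm, ← h1]
    simp only [Matrix.mul_assoc]
  have hcomm : E * D = D * E := by
    simp only [E, D, Matrix.diagonal_mul_diagonal, mul_comm]
  have h3 : E * (L * Q * L.transpose) * E = 0 := by
    have hz : L.transpose * (E * (L * Q * L.transpose) * E) * L = 0 := by
      rw [← h0, hL v]
      simp only [Matrix.mul_assoc, E]
    calc E * (L * Q * L.transpose) * E
        = (D * L * Q * L.transpose) * (E * (L * Q * L.transpose) * E) *
          (L * (D * L * Q).transpose) := by rw [h1, h1t, Matrix.one_mul, Matrix.mul_one]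
      _ = (D * L * Q) * (L.transpose * (E * (L * Q * L.transpose) * E) * L) *
          (D * L * Q).transpose := by simp only [Matrix.mul_assoc]
      _ = 0 := by rw [hz, Matrix.mul_zero, Matrix.zero_mul]
  have h4 : E * E = 0 := by
    calc E * E = E * (L * Q * L.transpose * D) * E := by rw [h2, Matrix.mul_one]
      _ = E * (L * Q * L.transpose) * (D * E) := by simp only [Matrix.mul_assoc]
      _ = 0 := by rw [← hcomm, ← Matrix.mul_assoc, h3, Matrix.zero_mul]
  have h5 : L.mulVec v = 0 := by
    rw [hE, Matrix.diagonal_mul_diagonal, Matrix.diagonal_eq_zero] at h4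
    funext a
    exact mul_self_eq_zero.1 (congrFun h4 a)
  rw [hL v, h5]
  simp

/-! ### The `2 × 2` matrix multiplication polynomial -/

theorem symProd_three_apply {ι : Type} (a b c : ι → ℂ) (x y z : ι) :
    symProd ![a, b, c] ![x, y, z] = 6⁻¹ * (a x * b y * c z + a x * c y * b z + b x * a y * c z +
      b x * c y * a z + c x * a y * b z + c x * b y * a z) := by
  have h : (Finset.univ : Finset (Equiv.Perm (Fin 3))) = {1, Equiv.swap 0 1, Equiv.swap 0 2,
      Equiv.swap 1 2, finRotate 3, (finRotate 3)⁻¹} := by decide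
  have h1 : ∀ f : Equiv.Perm (Fin 3) → ℂ, ∑ σ, f σ = f 1 + (f (Equiv.swap 0 1) +
      (f (Equiv.swap 0 2) + (f (Equiv.swap 1 2) + (f (finRotate 3) + f (finRotate 3)⁻¹)))) := by
    intro f
    rw [h, Finset.sum_insert (by decide), Finset.sum_insert (by decide),
      Finset.sum_insert (by decide), Finset.sum_insert (by decide), Finset.sum_insert (by decide),
      Finset.sum_singleton]
  have h2 : ∀ σ : Equiv.Perm (Fin 3), pureTensor (fun j => (![a, b, c] : Fin 3 → ι → ℂ) (σ j))
      ![x, y, z] = ![a, b, c] (σ 0) x * ![a, b, c] (σ 1) y * ![a, b, c] (σ 2) z :=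
    fun σ => Fin.prod_univ_three _
  have e0 : (finRotate 3)⁻¹ 0 = 2 := by decide
  have e1 : (finRotate 3)⁻¹ 1 = 0 := by decide
  have e2 : (finRotate 3)⁻¹ 2 = 1 := by decide
  have f0 : finRotate 3 0 = 1 := by decide
  have f1 : finRotate 3 1 = 2 := by decide
  have f2 : finRotate 3 2 = 0 := by decide
  have s0 : Equiv.swap (0 : Fin 3) 1 2 = 2 := by decide
  have s1 : Equiv.swap (0 : Fin 3) 2 1 = 1 := by decide
  have s2 : Equiv.swap (1 : Fin 3) 2 0 = 0 := by decide
  rw [symProd, Pi.smul_apply, Finset.sum_apply, h1]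
  simp only [h2]
  simp only [e0, e1, e2, f0, f1, f2, s0, s1, s2, Equiv.swap_apply_left,
    Equiv.swap_apply_right, Equiv.Perm.one_apply, Matrix.cons_val, smul_eq_mul]
  norm_num [Nat.factorial]
  ring

theorem matMulTensor_apply (x y z : Fin 2 × Fin 2) :
    matMulTensor ![x, y, z] =
      2⁻¹ * ((if x.2 = y.1 ∧ y.2 = z.1 ∧ z.2 = x.1 then 1 else 0) +
        (if x.2 = z.1 ∧ z.2 = y.1 ∧ y.2 = x.1 then 1 else 0)) := by
  simp only [matMulTensor, Pi.add_apply, Pi.smul_apply, symProd_three_apply, e, Pi.single_apply]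
  obtain ⟨x1, x2⟩ := x
  obtain ⟨y1, y2⟩ := y
  obtain ⟨z1, z2⟩ := z
  fin_cases x1 <;> fin_cases x2 <;> fin_cases y1 <;> fin_cases y2 <;> fin_cases z1 <;>
    fin_cases z2 <;> norm_num

theorem isSymm_matMulTensor : IsSymm matMulTensor :=
  (((isSymm_symProd _).add ((isSymm_symProd _).smul _)).add ((isSymm_symProd _).smul _)).add
    (isSymm_symProd _)

/-- The slice at the identity matrix is the trace form (A, B) ↦ tr(AB). Relative to it the slice at
u is the Jordan multiplication A ↦ (uA + Au)/2, and these operators do not commute for u = e₀₀, e₀₁.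
-/
theorem matMulTensor_mem :
    matMulTensor ∈ B (Fin 2 × Fin 2) 4 3 \ WBar (Fin 2 × Fin 2) 4 3 := by
  refine ⟨mem_B_of_card_le (by norm_num) (by simp) isSymm_matMulTensor, fun h => ?_⟩
  have hI : slice matMulTensor (fun x => if x.1 = x.2 then 1 else 0) =
      Matrix.of fun j l => if j = l.swap then 1 else 0 := by
    funext ⟨a, b⟩ ⟨c, d⟩
    simp only [slice, Matrix.of_apply, matMulTensor_apply, Fintype.sum_prod_type, Fin.sum_univ_two, Prod.swap]
    fin_cases a <;> fin_cases b <;> fin_cases c <;> fin_cases d <;> norm_num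
  have hQ : slice matMulTensor (fun x => if x.1 = x.2 then 1 else 0) *
      (Matrix.of fun j l : Fin 2 × Fin 2 => if j = l.swap then (1 : ℂ) else 0) = 1 := by
    rw [hI]
    ext ⟨a, b⟩ ⟨c, d⟩
    simp only [Matrix.mul_apply, Matrix.of_apply, Fintype.sum_prod_type, Fin.sum_univ_two, Prod.swap,
      Matrix.one_apply]
    fin_cases a <;> fin_cases b <;> fin_cases c <;> fin_cases d <;> norm_num
  have h1 := slice_mul_inv_mul_slice (T := matMulTensor) (by simpa using h.2) (e (0, 0)) (e (0, 1))
    _ hQ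
  -- Here the two sides differ by a quarter of tr(e₀₀[[e₀₀, e₀₁], e₁₀]) = 1.
  have h2 := congrFun (congrFun h1 (0, 0)) (1, 0)
  simp [Matrix.mul_apply, Matrix.of_apply, slice, matMulTensor_apply, Fintype.sum_prod_type, Fin.sum_univ_two, e,
    Pi.single_apply] at h2

/-! ### Strictness of both inclusions for ternary cubics -/

/-- The symmetric tensor of `6 x₀ x₁ x₂`. -/
def distinctTensor : Tensor (Fin 3) 3 := fun i => if Function.Injective i then 1 else 0

theorem isSymm_distinctTensor : IsSymm distinctTensor := by
  intro σ i
  simp [distinctTensor]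

theorem distinctTensor_apply (x y z : Fin 3) :
    distinctTensor ![x, y, z] = if x ≠ y ∧ x ≠ z ∧ y ≠ z then 1 else 0 := by
  have : ∀ x y z : Fin 3, Function.Injective ![x, y, z] ↔ x ≠ y ∧ x ≠ z ∧ y ≠ z := by decide
  simp only [distinctTensor, this]

theorem distinctTensor_mem : distinctTensor ∈ B (Fin 3) 3 3 \ WBar (Fin 3) 3 3 := by
  refine ⟨mem_B_of_card_le (by norm_num) (by simp) isSymm_distinctTensor, fun h => ?_⟩
  -- With J the all-ones matrix, this slice is J − I, with inverse J/2 − I.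
  have hQ : slice distinctTensor (fun _ => 1) *
      (Matrix.of fun j l : Fin 3 => if j = l then (-2⁻¹ : ℂ) else 2⁻¹) = 1 := by
    ext a b
    simp only [Matrix.mul_apply, Matrix.of_apply, slice, distinctTensor_apply, Fin.sum_univ_three,
      Matrix.one_apply]
    fin_cases a <;> fin_cases b <;> simp <;> norm_num
  have h1 := slice_mul_inv_mul_slice (T := distinctTensor) (by simpa using h.2) (e 0) (e 1) _ hQ
  have h2 := congrFun (congrFun h1 1) 2
  simp [Matrix.mul_apply, Matrix.of_apply, slice, distinctTensor_apply, Fin.sum_univ_three, e,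
    Pi.single_apply] at h2

/-- The symmetric tensor of `x₀² x₁ + x₂³`. -/
def cuspTensor : Tensor (Fin 3) 3 := monomialTensor 3 0 1 + pureTensor fun _ => e 2

theorem cuspTensor_apply (x y z : Fin 3) :
    cuspTensor ![x, y, z] = 3⁻¹ * ((if x = 0 ∧ y = 0 ∧ z = 1 then 1 else 0) +
      (if x = 0 ∧ y = 1 ∧ z = 0 then 1 else 0) + (if x = 1 ∧ y = 0 ∧ z = 0 then 1 else 0)) +
      (if x = 2 ∧ y = 2 ∧ z = 2 then 1 else 0) := by
  have hm : monomialTensor 3 (0 : Fin 3) 1 = symProd ![e 1, e 0, e 0] := by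
    unfold monomialTensor
    congr 1
    funext j
    fin_cases j <;> rfl
  have hp : pureTensor (fun _ : Fin 3 => (e 2 : Fin 3 → ℂ)) ![x, y, z] =
      if x = 2 ∧ y = 2 ∧ z = 2 then 1 else 0 := by
    rw [pureTensor, Fin.prod_univ_three]
    simp only [Matrix.cons_val, e, Pi.single_apply]
    by_cases hx : x = 2 <;> by_cases hy : y = 2 <;> simp [hx, hy]
  simp only [cuspTensor, Pi.add_apply, hm, symProd_three_apply, hp]
  simp only [e, Pi.single_apply]
  fin_cases x <;> fin_cases y <;> fin_cases z <;> simp <;> norm_num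

/-- Adding one cube to a limit of sums of two cubes gives border rank at most 3. Waring rank 3 fails
because the slice at e₁ is a nonzero multiple of E₀₀, which is nilpotent relative to an invertible
slice. -/
theorem cuspTensor_mem : cuspTensor ∈ WBar (Fin 3) 3 3 \ W (Fin 3) 3 3 := by
  refine ⟨⟨(isSymm_symProd _).add (isSymm_pureTensor _), ?_⟩, fun h => ?_⟩
  · rw [borderWaringRank_le_iff]
    have h2 := (borderWaringRank_le_iff _).1
      (borderWaringRank_symProd_le (d := 3) (k := 2) (by norm_num) le_rfl
        (e (0 : Fin 3)) (e 1))
    have hc : Continuous fun T : Tensor (Fin 3) 3 => T + pureTensor fun _ => e 2 :=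
      continuous_id.add continuous_const
    refine map_mem_closure (f := fun T : Tensor (Fin 3) 3 => T + pureTensor fun _ => e 2) hc h2
      fun S hS => ?_
    obtain ⟨l, hl⟩ := (waringRank_le_iff (by norm_num) S).1 hS
    refine (waringRank_le_iff (by norm_num) _).2 ⟨Fin.snoc l (e 2), ?_⟩
    rw [Fin.sum_univ_castSucc, hl]
    simp only [Fin.snoc_castSucc, Fin.snoc_last]
  -- The 3 cancels the coefficient 1/3, so this slice is the permutation matrix of the swap of 0 and
  -- 1, its own inverse.
  · have hQ : slice cuspTensor ![3, 0, 1] *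
        (Matrix.of fun j l : Fin 3 => if j = Equiv.swap 0 1 l then (1 : ℂ) else 0) = 1 := by
      ext a b
      simp only [Matrix.mul_apply, Matrix.of_apply, slice, cuspTensor_apply, Fin.sum_univ_three,
        Matrix.one_apply]
      fin_cases a <;> fin_cases b <;> simp [Equiv.swap_apply_def]
    have h0 := slice_eq_zero_of_mul_inv_mul_eq_zero (T := cuspTensor) (by simpa using h.2) (e 1) _
      hQ (by
        ext a b
        simp only [Matrix.mul_apply, Matrix.of_apply, slice, cuspTensor_apply, Fin.sum_univ_three, e,
          Pi.single_apply]
        fin_cases a <;> fin_cases b <;> simp [Equiv.swap_apply_def])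
    have h1 := congrFun (congrFun h0 0) 0
    simp [slice, cuspTensor_apply, e, Pi.single_apply] at h1

theorem ssubset_of_mem_diff {α : Type*} {s t : Set α} {x : α} (h : s ⊆ t) (hx : x ∈ t \ s) :
    s ⊂ t :=
  ⟨h, fun h' => hx.2 (h' hx.1)⟩

end WaringABP
end

theorem mainTheorem9 :
    (∀ m k d : ℕ, 1 ≤ k → 1 ≤ d →
      WaringABP.W (Fin m) k d ⊆ WaringABP.WBar (Fin m) k d ∧
      WaringABP.WBar (Fin m) k d ⊆ WaringABP.B (Fin m) k d ∧
      WaringABP.B (Fin m) k d = WaringABP.BBar (Fin m) k d) ∧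
    (∃ m k d : ℕ, 1 ≤ k ∧ 1 ≤ d ∧
      WaringABP.W (Fin m) k d ⊂ WaringABP.WBar (Fin m) k d ∧
      WaringABP.WBar (Fin m) k d ⊂ WaringABP.B (Fin m) k d) ∧
    (∀ (m k d : ℕ) (x y : Fin m), x ≠ y → 2 ≤ k → k < d →
      WaringABP.monomialTensor d x y ∈ WaringABP.WBar (Fin m) k d \ WaringABP.W (Fin m) k d) ∧
    WaringABP.matMulTensor ∈
      WaringABP.B (Fin 2 × Fin 2) 4 3 \ WaringABP.WBar (Fin 2 × Fin 2) 4 3 := by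
  refine ⟨fun m k d hk hd => ⟨WaringABP.W_subset_WBar _ k d, WaringABP.WBar_subset_B hk hd,
    WaringABP.B_eq_BBar hk hd⟩, ⟨3, 3, 3, by norm_num, by norm_num, ?_, ?_⟩,
    fun m k d x y hxy hk hkd => WaringABP.monomialTensor_mem hxy hk hkd,
    WaringABP.matMulTensor_mem⟩
  · exact WaringABP.ssubset_of_mem_diff (WaringABP.W_subset_WBar _ 3 3) WaringABP.cuspTensor_mem
  · exact WaringABP.ssubset_of_mem_diff (WaringABP.WBar_subset_B (by norm_num) (by norm_num))
      WaringABP.distinctTensor_mem
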